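/- Let $N\ge 0$ and let $D=D_0\setminus\bigcup_{i=1}^N \overline{D_i}\subset\mathbb R^2$, where $D_0,\dots,D_N$ are simply connected bounded domains with smooth boundaries $\Gamma_0,\dots,\Gamma_N$, the closures $\overline{D_1},\dots,\overline{D_N}$ are pairwise disjoint, and $\overline{D_i}\subset D_0$ for $1\le i\le N$. For $1\le i\le N$ let $\zeta_i$ be the solution of $\Delta\zeta_i=0$ in $D$, $\zeta_i=1$ on $\Gamma_i$, $\zeta_i=0$ on $\Gamma_j$ for $0\le j\le N$, $j\ne i$. Put $p_{ij}=\int_D\nabla\zeta_i\cdot\nabla\zeta_j\,dx$ and $(q_{ij})=(p_{ij})^{-1}$. For $\phi\in L^2(D)$ let $\mathcal G\phi\in H^1_0(D)$ be the solution of $-\Delta\mathcal G\phi=\phi$ in $D$, and $$\mathcal P\phi=\mathcal G\phi+\sum_{i,j=1}^N q_{ij}\Big(\int_D\zeta_i\phi\,dx\Big)\zeta_j .$$ Let $$\mathcal X=\Big\{u\in H^1(D)\ :\ u=v+\sum_{i=1}^N\theta_i\zeta_i,\ v\in H^1_0(D),\ \theta_1,\dots,\theta_N\in\mathbb R\Big\},$$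 $$\lambda=\inf\Big\{\int_D|\nabla u|^2dx\ :\ u\in\mathcal X,\ \|u\|_{L^2(D)}=1\Big\},\qquad \Lambda=\sup\Big\{\int_D\phi\,\mathcal P\phi\,dx\ :\ \phi\in L^2(D),\ \|\phi\|_{L^2(D)}=1\Big\}.$$ Then: (i) $\lambda\Lambda=1$; (ii) if $\tilde\phi$ is a maximizer for $\Lambda$ (that is, $\|\tilde\phi\|_{L^2(D)}=1$ and the supremum is attained at $\tilde\phi$), then $\Lambda^{-1}\mathcal P\tilde\phi$ is a minimizer for $\lambda$; (iii) if $\tilde u$ is a minimizer for $\lambda$ (that is, $\tilde u\in\mathcal X$, $\|\tilde u\|_{L^2(D)}=1$ and the infimum is attained at $\tilde u$), then $\Delta\tilde u\in L^2(D)$ in the sense of distributions, and $\lambda^{-1}(-\Delta\tilde u)$ is a maximizer for $\Lambda$. -/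

import Mathlib

open MeasureTheory Filter Topology
open scoped ContDiff ENNReal Distributions

noncomputable section

namespace HoledDomain

/-- The Euclidean plane. -/
abbrev Plane : Type := EuclideanSpace ℝ (Fin 2)

/-- `Ω` has a smooth boundary: near every boundary point, `Ω` is the sublevel set `{ρ < 0}` of a
smooth function `ρ` whose differential does not vanish at that point. -/
def HasSmoothBoundary (Ω : Set Plane) : Prop :=
  ∀ p ∈ frontier Ω, ∃ (U : Set Plane) (ρ : Plane → ℝ), IsOpen U ∧ p ∈ U ∧
    ContDiffOn ℝ ∞ ρ U ∧ fderiv ℝ ρ p ≠ 0 ∧ Ω ∩ U = {x ∈ U | ρ x < 0}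

/-- A simply connected bounded planar domain with a smooth boundary. (Simple connectedness includes
non-emptiness and path-connectedness.) -/
structure IsSmoothSimplyConnectedDomain (Ω : Set Plane) : Prop where
  isOpen : IsOpen Ω
  isBounded : Bornology.IsBounded Ω
  simplyConnected : IsSimplyConnected Ω
  smoothBoundary : HasSmoothBoundary Ω

/-! ### Sobolev notions on an open subset of the plane -/

section Sobolev

variable (D : TopologicalSpace.Opens Plane)

/-- Lebesgue measure on `D`. -/
abbrev vol : Measure Plane := volume.restrict (D : Set Plane)

/-- The space `L²(D)` of real functions. -/
abbrev L2 : Type := Lp ℝ 2 (vol D)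

/-- The space `L²(D; ℝ²)` of vector fields. -/
abbrev L2Vec : Type := Lp Plane 2 (vol D)

/-- `g` is the weak gradient of `u`: `∫ u ∇ψ = - ∫ ψ g` for every test function `ψ ∈ C_c^∞(D)`. -/
def HasWeakGradient (u : L2 D) (g : L2Vec D) : Prop :=
  ∀ ψ : 𝓓(D, ℝ), ∫ x, u x • gradient ψ x ∂(vol D) = - ∫ x, ψ x • g x ∂(vol D)

/-- `f` is the Laplacian of `u` in the sense of distributions on `D`: `∫ u Δψ = ∫ f ψ` for every
test function `ψ ∈ C_c^∞(D)`. -/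
def HasWeakLaplacian (u f : L2 D) : Prop :=
  ∀ ψ : 𝓓(D, ℝ),
    ∫ x, u x * Laplacian.laplacian (ψ : Plane → ℝ) x ∂(vol D) = ∫ x, f x * ψ x ∂(vol D)

/-- The Sobolev space `H¹(D)`, as a subset of `L²(D)`. -/
def H1 : Set (L2 D) := {u | ∃ g : L2Vec D, HasWeakGradient D u g}

/-- The weak gradient of `u ∈ H¹(D)` (it is unique; arbitrary if `u ∉ H¹(D)`). -/
def weakGradient (u : L2 D) : L2Vec D := Classical.epsilon (HasWeakGradient D u)

/-- The Sobolev space `H¹₀(D)`: the closure of `C_c^∞(D)` in `H¹(D)`. -/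
def H10 : Set (L2 D) :=
  {v | ∃ g : L2Vec D, HasWeakGradient D v g ∧ ∃ ψ : ℕ → 𝓓(D, ℝ),
    Tendsto (fun n => eLpNorm (fun x => v x - ψ n x) 2 (vol D)) atTop (𝓝 0) ∧
    Tendsto (fun n => eLpNorm (fun x => g x - gradient (ψ n) x) 2 (vol D)) atTop (𝓝 0)}

/-- The Dirichlet energy `∫_D |∇u|²`. -/
def dirichletEnergy (u : L2 D) : ℝ := ∫ x, ‖weakGradient D u x‖ ^ 2 ∂(vol D)

/-- The Green operator: `green D φ` is the solution `w ∈ H¹₀(D)` of `-Δw = φ`. -/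
def green (φ : L2 D) : L2 D :=
  Classical.epsilon fun w => w ∈ H10 D ∧ HasWeakLaplacian D w (-φ)

end Sobolev

/-- The data of a bounded domain with `N` holes: a simply connected bounded smooth domain `outer`
and `N` simply connected bounded smooth domains `hole i` with pairwise disjoint closures contained
in `outer`. -/
structure MultiplyConnected (N : ℕ) where
  outer : Set Plane
  hole : Fin N → Set Plane
  outer_smooth : IsSmoothSimplyConnectedDomain outer
  hole_smooth : ∀ i, IsSmoothSimplyConnectedDomain (hole i)
  hole_subset : ∀ i, closure (hole i) ⊆ outer
  hole_disjoint : ∀ i j, i ≠ j → Disjoint (closure (hole i)) (closure (hole j))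

namespace MultiplyConnected

variable {N : ℕ} (M : MultiplyConnected N)

/-- The domain `D`: the outer domain with the closed holes removed. Its boundary consists of
`Γ₀ = frontier outer` and `Γᵢ = frontier (hole i)`. -/
def domain : TopologicalSpace.Opens Plane :=
  ⟨M.outer \ ⋃ i, closure (M.hole i),
    M.outer_smooth.isOpen.sdiff (isClosed_iUnion_of_finite fun _ => isClosed_closure)⟩

/-- `ζ ∈ H¹(D)` is the harmonic function with boundary values `1` on `Γᵢ` and `0` on the other
boundary components: `Δζ = 0` in `D`, and `ζ - χ ∈ H¹₀(D)` for a smooth function `χ` that equals `1`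
near `Γᵢ` and `0` near `Γ₀` and near `Γⱼ`, `j ≠ i`. -/
def IsHarmonicPotential (i : Fin N) (ζ : L2 M.domain) : Prop :=
  ζ ∈ H1 M.domain ∧ HasWeakLaplacian M.domain ζ 0 ∧
    ∃ χ : Plane → ℝ, ContDiff ℝ ∞ χ ∧
      (∀ᶠ x in 𝓝ˢ (frontier M.outer), χ x = 0) ∧
      (∀ j, ∀ᶠ x in 𝓝ˢ (frontier (M.hole j)), χ x = if j = i then 1 else 0) ∧
      ∃ v ∈ H10 M.domain, ∀ᵐ x ∂(vol M.domain), ζ x = v x + χ x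

/-- The harmonic function `ζᵢ` with `ζᵢ = δᵢⱼ` on `Γⱼ` for `j = 0, …, N`. -/
def zeta (i : Fin N) : L2 M.domain := Classical.epsilon (M.IsHarmonicPotential i)

/-- The matrix `pᵢⱼ = ∫_D ∇ζᵢ · ∇ζⱼ`. -/
def p : Matrix (Fin N) (Fin N) ℝ := Matrix.of fun i j =>
  ∫ x, inner ℝ (weakGradient M.domain (M.zeta i) x) (weakGradient M.domain (M.zeta j) x)
    ∂(vol M.domain)

/-- The inverse matrix `q = p⁻¹`. -/
def q : Matrix (Fin N) (Fin N) ℝ := M.p⁻¹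

/-- The operator `𝒫φ = 𝒢φ + ∑ᵢⱼ qᵢⱼ (∫_D ζᵢ φ) ζⱼ`. -/
def opP (φ : L2 M.domain) : L2 M.domain :=
  green M.domain φ +
    ∑ i, ∑ j, (M.q i j * ∫ x, M.zeta i x * φ x ∂(vol M.domain)) • M.zeta j

/-- The space `𝒳` of all `u ∈ H¹(D)` of the form `u = v + ∑ᵢ θᵢ ζᵢ`, `v ∈ H¹₀(D)`, `θᵢ ∈ ℝ`. -/
def spaceX : Set (L2 M.domain) :=
  {u | u ∈ H1 M.domain ∧
    ∃ v ∈ H10 M.domain, ∃ θ : Fin N → ℝ, u = v + ∑ i, θ i • M.zeta i}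

/-- `λ = inf {∫_D |∇u|² : u ∈ 𝒳, ‖u‖ = 1}`. -/
def lam : ℝ :=
  sInf {e | ∃ u ∈ M.spaceX, ‖u‖ = 1 ∧ e = dirichletEnergy M.domain u}

/-- The quadratic form `∫_D φ 𝒫φ`. -/
def formP (φ : L2 M.domain) : ℝ := ∫ x, φ x * M.opP φ x ∂(vol M.domain)

/-- `Λ = sup {∫_D φ 𝒫φ : φ ∈ L²(D), ‖φ‖ = 1}`. -/
def Lam : ℝ := sSup {e | ∃ φ : L2 M.domain, ‖φ‖ = 1 ∧ e = M.formP φ}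

/-- `u` is a minimizer for `λ`. -/
def IsMinimizer (u : L2 M.domain) : Prop :=
  u ∈ M.spaceX ∧ ‖u‖ = 1 ∧ dirichletEnergy M.domain u = M.lam

/-- `φ` is a maximizer for `Λ`. -/
def IsMaximizer (φ : L2 M.domain) : Prop :=
  ‖φ‖ = 1 ∧ M.formP φ = M.Lam

end MultiplyConnected

end HoledDomain

end

noncomputable section

namespace HoledDomain

/-! ### Duality between a Dirichlet quotient and the quadratic form of its solution operator -/

section Duality

variable {E V : Type*} [NormedAddCommGroup E] [InnerProductSpace ℝ E]
  [NormedAddCommGroup V] [InnerProductSpace ℝ V]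

/-! The operator `𝒫` inverts the Dirichlet form on `𝒳`: for all `w ∈ 𝒳`, `∫ ∇𝒫φ · ∇w = ∫ φ w`. Given
this identity and a Poincaré inequality on `𝒳`, everything else is Cauchy–Schwarz in an inner
product space (`SolutionOperator`). Bounding `⟪φ, Pφ⟫ = ‖G(Pφ)‖²` from above gives `Λ ≤ λ⁻¹`, and `1
= ⟪G(Pu), Gu⟫` for unit `u ∈ X` gives the converse. Equality cases identify the optimizers: a
maximizer satisfies `Pφ = Λφ` and a minimizer satisfies `G(Pu) = λ⁻¹ Gu`. No compactness, spectral
theory or existence of optimizers is needed.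

The analytic work is to verify `solutionOperator`. Gradients of the `ζⱼ` are orthogonal to those of
`H¹₀` by harmonicity, so the form splits into a Green part and a finite-dimensional part inverted by
`q`. Boundary traces are avoided: an element of `𝒳` is a limit of smooth compactly supported
functions on the plane that are locally constant off `D`, and `exists_poincare` bounds both such a
function on `D` and its constants on the holes by the gradient on `D`. Since the holes have positive
measure, this also makes the Gram matrix `p` invertible. -/

/-- The infimum of `‖G u‖²` over the unit vectors `u` of `X`. -/
def quotientInf (X : Set E) (G : E → V) : ℝ :=
  sInf {e | ∃ u ∈ X, ‖u‖ = 1 ∧ e = ‖G u‖ ^ 2}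

/-- The supremum of `⟪φ, P φ⟫` over the unit vectors `φ`. -/
def formSup (P : E → E) : ℝ := sSup {e | ∃ φ : E, ‖φ‖ = 1 ∧ e = inner ℝ φ (P φ)}

/-- `P` solves the variational problem `⟪G (P φ), G w⟫ = ⟪φ, w⟫` for `w ∈ X`, in a set `X` on which
a Poincaré inequality holds. -/
structure SolutionOperator (X : Set E) (G : E → V) (P : E → E) : Prop where
  smul_mem : ∀ (c : ℝ), ∀ u ∈ X, c • u ∈ X
  map_smul : ∀ (c : ℝ), ∀ u ∈ X, G (c • u) = c • G u
  mem : ∀ φ, P φ ∈ X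
  inner_map : ∀ φ, ∀ w ∈ X, inner ℝ (G (P φ)) (G w) = inner ℝ φ w
  poincare : ∃ C : ℝ, ∀ u ∈ X, ‖u‖ ≤ C * ‖G u‖
  exists_unit : ∃ u ∈ X, ‖u‖ = 1

namespace SolutionOperator

variable {X : Set E} {G : E → V} {P : E → E} (h : SolutionOperator X G P)
include h

theorem inner_self (φ : E) : inner ℝ φ (P φ) = ‖G (P φ)‖ ^ 2 := by
  rw [← h.inner_map φ _ (h.mem φ), real_inner_self_eq_norm_sq]

theorem quotientInf_pos : 0 < quotientInf X G := by
  obtain ⟨C, hC⟩ := h.poincare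
  obtain ⟨u₀, hu₀, hn₀⟩ := h.exists_unit
  -- The Poincaré constant carries no sign, so `max C 1` replaces it to allow inversion.
  have key : ∀ u ∈ X, ‖u‖ = 1 → (max C 1)⁻¹ ^ 2 ≤ ‖G u‖ ^ 2 := by
    intro u hu hn
    have h1 : 1 ≤ max C 1 * ‖G u‖ := by
      rw [← hn]
      exact (hC u hu).trans (by gcongr; exact le_max_left _ _)
    have h0 : 0 < max C 1 := lt_of_lt_of_le one_pos (le_max_right _ _)
    gcongr
    rwa [inv_le_iff_one_le_mul₀' h0]
  have h0 : 0 < max C 1 := lt_of_lt_of_le one_pos (le_max_right _ _)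
  refine lt_of_lt_of_le (by positivity : 0 < (max C 1)⁻¹ ^ 2) ?_
  refine le_csInf ⟨_, u₀, hu₀, hn₀, rfl⟩ ?_
  rintro _ ⟨u, hu, hn, rfl⟩
  exact key u hu hn

theorem quotientInf_mul_le {u : E} (hu : u ∈ X) : quotientInf X G * ‖u‖ ^ 2 ≤ ‖G u‖ ^ 2 := by
  by_cases h0 : u = 0
  · rw [h0, norm_zero, zero_pow two_ne_zero, mul_zero]
    positivity
  have hn : 0 < ‖u‖ := norm_pos_iff.2 h0
  have h1 : quotientInf X G ≤ ‖G (‖u‖⁻¹ • u)‖ ^ 2 :=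
    csInf_le ⟨0, by rintro _ ⟨u, _, _, rfl⟩; positivity⟩ ⟨_, h.smul_mem ‖u‖⁻¹ u hu,
      by rw [norm_smul, norm_inv, norm_norm, inv_mul_cancel₀ hn.ne'], rfl⟩
  rw [h.map_smul _ _ hu, norm_smul, norm_inv, norm_norm, mul_pow] at h1
  calc quotientInf X G * ‖u‖ ^ 2 ≤ (‖u‖⁻¹ ^ 2 * ‖G u‖ ^ 2) * ‖u‖ ^ 2 := by gcongr
    _ = ‖G u‖ ^ 2 := by field_simp

/-- With `μ` the infimum, `μ ‖Pφ‖² ≤ ‖G(Pφ)‖² = ⟪φ, Pφ⟫ ≤ ‖φ‖ ‖Pφ‖`; then divide by `‖Pφ‖`. -/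
theorem quotientInf_mul_norm_le (φ : E) : quotientInf X G * ‖P φ‖ ≤ ‖φ‖ := by
  have h1 := h.quotientInf_mul_le (h.mem φ)
  rw [← h.inner_self] at h1
  have h2 := real_inner_le_norm φ (P φ)
  rcases (norm_nonneg (P φ)).eq_or_lt with h0 | h0
  · rw [← h0, mul_zero]
    positivity
  · nlinarith

theorem inner_le (φ : E) (hφ : ‖φ‖ = 1) : inner ℝ φ (P φ) ≤ (quotientInf X G)⁻¹ := by
  have h1 := h.quotientInf_mul_norm_le φ
  have h2 := real_inner_le_norm φ (P φ)
  rw [hφ] at h1 h2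
  have := h.quotientInf_pos
  rw [← one_div, le_div_iff₀ this]
  nlinarith

theorem inner_le_formSup (φ : E) (hφ : ‖φ‖ = 1) : inner ℝ φ (P φ) ≤ formSup P :=
  le_csSup ⟨(quotientInf X G)⁻¹, by rintro _ ⟨φ, hn, rfl⟩; exact h.inner_le φ hn⟩ ⟨φ, hφ, rfl⟩

/-- The upper bound is `inner_le`. For the lower one, a unit `u ∈ X` gives `1 = ⟪G(Pu), Gu⟫² ≤
‖G(Pu)‖² ‖Gu‖²`, and `‖G(Pu)‖² = ⟪u, Pu⟫` is at most the supremum. -/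
theorem formSup_eq : formSup P = (quotientInf X G)⁻¹ := by
  obtain ⟨u₀, hu₀, hn₀⟩ := h.exists_unit
  have key : ∀ u ∈ X, ‖u‖ = 1 → 1 ≤ formSup P * ‖G u‖ ^ 2 := by
    intro u hu hn
    have h1 := h.inner_map u u hu
    rw [real_inner_self_eq_norm_sq, hn] at h1
    have h2 := real_inner_le_norm (G (P u)) (G u)
    have h3 := h.inner_le_formSup u hn
    rw [h.inner_self] at h3
    calc (1 : ℝ) ≤ (‖G (P u)‖ * ‖G u‖) ^ 2 := by nlinarith
      _ = ‖G (P u)‖ ^ 2 * ‖G u‖ ^ 2 := by ring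
      _ ≤ formSup P * ‖G u‖ ^ 2 := by gcongr
  have hpos : 0 < formSup P := by
    by_contra! hle
    have := key u₀ hu₀ hn₀
    nlinarith [sq_nonneg ‖G u₀‖]
  apply le_antisymm
  · refine csSup_le ⟨_, u₀, hn₀, rfl⟩ ?_
    rintro _ ⟨φ, hn, rfl⟩
    exact h.inner_le φ hn
  · apply inv_le_of_inv_le₀ hpos
    refine le_csInf ⟨_, u₀, hu₀, hn₀, rfl⟩ ?_
    rintro _ ⟨u, hu, hn, rfl⟩
    rw [← one_div, div_le_iff₀ hpos, mul_comm]
    exact key u hu hn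

theorem quotientInf_mul_formSup : quotientInf X G * formSup P = 1 := by
  rw [h.formSup_eq, mul_inv_cancel₀ h.quotientInf_pos.ne']

/-- Equality case of Cauchy–Schwarz: with `Λ` the supremum, `‖Pφ‖ ≤ Λ`, so `‖Pφ - Λφ‖² = ‖Pφ‖² - 2Λ²
+ Λ² ≤ 0`. -/
theorem eq_smul_of_maximizer {φ : E} (hn : ‖φ‖ = 1) (hφ : inner ℝ φ (P φ) = formSup P) :
    P φ = formSup P • φ := by
  have h1 := h.quotientInf_mul_norm_le φ
  have hpos := h.quotientInf_pos
  have h2 : ‖P φ‖ ≤ formSup P := by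
    rw [h.formSup_eq, ← one_div, le_div_iff₀ hpos, mul_comm, ← hn]
    exact h1
  have h3 : ‖P φ - formSup P • φ‖ ^ 2 ≤ 0 := by
    rw [norm_sub_sq_real, inner_smul_right, real_inner_comm, hφ, norm_smul, hn, mul_one,
      Real.norm_eq_abs, sq_abs]
    nlinarith [norm_nonneg (P φ)]
  exact sub_eq_zero.1 (norm_eq_zero.1 (pow_eq_zero_iff two_ne_zero |>.1
    (le_antisymm h3 (sq_nonneg _))))

/-- Expanding `‖G(Pu) - μ⁻¹ Gu‖²`, with `μ` the infimum, the three terms are at most `μ⁻¹`, equal to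
`-2μ⁻¹`, and equal to `μ⁻¹`. Only the images under `G` are compared, so injectivity of `G` plays no
role. -/
theorem map_eq_smul_of_minimizer {u : E} (hu : u ∈ X) (hn : ‖u‖ = 1)
    (hG : ‖G u‖ ^ 2 = quotientInf X G) : G (P u) = (quotientInf X G)⁻¹ • G u := by
  have hpos := h.quotientInf_pos
  have h3 : ‖G (P u) - (quotientInf X G)⁻¹ • G u‖ ^ 2 ≤ 0 := by
    rw [norm_sub_sq_real, inner_smul_right, h.inner_map _ _ hu, real_inner_self_eq_norm_sq, hn,
      norm_smul, mul_pow, hG, ← h.inner_self, norm_inv, Real.norm_eq_abs, inv_pow, sq_abs]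
    have := h.inner_le u hn
    have h4 : (quotientInf X G ^ 2)⁻¹ * quotientInf X G = (quotientInf X G)⁻¹ := by
      field_simp
    rw [h4]
    linarith
  exact sub_eq_zero.1 (norm_eq_zero.1 (pow_eq_zero_iff two_ne_zero |>.1
    (le_antisymm h3 (sq_nonneg _))))

end SolutionOperator

end Duality

/-! ### Test functions and their gradients as elements of `L²` -/

section TestFunctions

variable (D : TopologicalSpace.Opens Plane)

/-- The smooth functions with compact support in the whole plane. -/
abbrev SmoothCompact : Type := 𝓓((⊤ : TopologicalSpace.Opens Plane), ℝ)

namespace SmoothCompact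

/-- A smooth function with compact support, as a `SmoothCompact`. -/
def mk' (f : Plane → ℝ) (hf : ContDiff ℝ ∞ f) (hc : HasCompactSupport f) : SmoothCompact :=
  ⟨f, hf, hc, Set.subset_univ _⟩

theorem smooth (ψ : SmoothCompact) : ContDiff ℝ ∞ ψ := ψ.contDiff

theorem differentiable (ψ : SmoothCompact) : Differentiable ℝ ψ :=
  ψ.smooth.differentiable (by simp)

theorem continuous_fderiv (ψ : SmoothCompact) : Continuous (fderiv ℝ ψ) :=
  ψ.smooth.continuous_fderiv (by simp)

theorem continuous_gradient (ψ : SmoothCompact) : Continuous (gradient ψ) :=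
  (InnerProductSpace.toDual ℝ Plane).symm.continuous.comp ψ.continuous_fderiv

theorem hasCompactSupport_gradient (ψ : SmoothCompact) : HasCompactSupport (gradient ψ) :=
  ψ.hasCompactSupport.fderiv ℝ |>.comp_left
    (g := (InnerProductSpace.toDual ℝ Plane).symm) (map_zero _)

theorem memLp (ψ : SmoothCompact) (μ : Measure Plane) [IsFiniteMeasureOnCompacts μ] :
    MemLp ψ 2 μ :=
  ψ.continuous.memLp_of_hasCompactSupport ψ.hasCompactSupport

theorem memLp_gradient (ψ : SmoothCompact) (μ : Measure Plane) [IsFiniteMeasureOnCompacts μ] :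
    MemLp (gradient ψ) 2 μ :=
  ψ.continuous_gradient.memLp_of_hasCompactSupport ψ.hasCompactSupport_gradient

theorem gradient_add (ψ χ : SmoothCompact) :
    gradient (ψ + χ : SmoothCompact) = gradient ψ + gradient χ := by
  ext1 x
  have : fderiv ℝ (ψ + χ : SmoothCompact) x = fderiv ℝ ψ x + fderiv ℝ χ x :=
    fderiv_add (ψ.differentiable x) (χ.differentiable x)
  rw [gradient, this, map_add]
  rfl

theorem gradient_smul (c : ℝ) (ψ : SmoothCompact) :
    gradient (c • ψ : SmoothCompact) = c • gradient ψ := by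
  ext1 x
  have : fderiv ℝ (c • ψ : SmoothCompact) x = c • fderiv ℝ ψ x :=
    fderiv_const_smul (ψ.differentiable x) c
  rw [gradient, this, map_smul]
  rfl

/-- The directional derivative. -/
def dir (e : Plane) (ψ : SmoothCompact) : SmoothCompact :=
  mk' (fun x => fderiv ℝ ψ x e)
    ((ψ.smooth.fderiv_right (m := ∞) (by simp)).clm_apply contDiff_const)
    (ψ.hasCompactSupport.fderiv_apply ℝ e)

theorem dir_apply (e : Plane) (ψ : SmoothCompact) (x : Plane) : ψ.dir e x = fderiv ℝ ψ x e := rfl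

theorem tsupport_dir_subset (e : Plane) (ψ : SmoothCompact) : tsupport (ψ.dir e) ⊆ tsupport ψ := by
  refine (closure_mono ?_).trans (tsupport_fderiv_subset ℝ (f := ψ))
  intro x hx h0
  exact hx (by simp [dir_apply, h0])

end SmoothCompact

/-- Restriction of smooth compactly supported functions to `D`, as a map to `L²(D)`. -/
def toL2 : SmoothCompact →ₗ[ℝ] L2 D where
  toFun ψ := (ψ.memLp (vol D)).toLp ψ
  map_add' _ _ := rfl
  map_smul' _ _ := rfl

/-- Gradients on `D` of smooth compactly supported functions, as a map to `L²(D; ℝ²)`. -/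
def gradL2 : SmoothCompact →ₗ[ℝ] L2Vec D where
  toFun ψ := (ψ.memLp_gradient (vol D)).toLp (gradient ψ)
  map_add' ψ χ := by
    rw [← MemLp.toLp_add]
    exact MemLp.toLp_congr _ _ (by rw [SmoothCompact.gradient_add])
  map_smul' c ψ := by
    rw [RingHom.id_apply, ← MemLp.toLp_const_smul]
    exact MemLp.toLp_congr _ _ (by rw [SmoothCompact.gradient_smul])

/-- The constant direction `e`, weighted by a smooth compactly supported function. -/
def fieldL2 (e : Plane) (ψ : SmoothCompact) : L2Vec D :=
  ((ψ.continuous.smul continuous_const).memLp_of_hasCompactSupport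
    (ψ.hasCompactSupport.smul_right (f' := fun _ => e))).toLp (fun x => ψ x • e)

theorem coeFn_toL2 (ψ : SmoothCompact) : toL2 D ψ =ᵐ[vol D] ψ :=
  MemLp.coeFn_toLp (ψ.memLp (vol D))

theorem coeFn_gradL2 (ψ : SmoothCompact) : gradL2 D ψ =ᵐ[vol D] gradient ψ :=
  MemLp.coeFn_toLp (ψ.memLp_gradient (vol D))

theorem coeFn_fieldL2 (e : Plane) (ψ : SmoothCompact) :
    fieldL2 D e ψ =ᵐ[vol D] fun x => ψ x • e := MemLp.coeFn_toLp _

/-- The smooth functions with compact support in `D`. -/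
def supportedIn : Submodule ℝ SmoothCompact where
  carrier := {ψ | tsupport ψ ⊆ D}
  add_mem' {ψ χ} h h' := (tsupport_add ψ χ).trans (Set.union_subset h h')
  zero_mem' := by
    have : tsupport (0 : Plane → ℝ) ⊆ D := by simp [tsupport_zero]
    exact this
  smul_mem' c ψ h := (tsupport_smul_subset_right (fun _ => c) ψ).trans h

variable {D}

theorem dir_mem_supportedIn {ψ : SmoothCompact} (hψ : ψ ∈ supportedIn D) (e : Plane) :
    ψ.dir e ∈ supportedIn D :=
  (ψ.tsupport_dir_subset e).trans hψ

/-- The extension of a test function on `D`. -/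
def ofTest (ψ : 𝓓(D, ℝ)) : SmoothCompact := .mk' ψ ψ.contDiff ψ.hasCompactSupport

theorem ofTest_mem (ψ : 𝓓(D, ℝ)) : ofTest ψ ∈ supportedIn D := ψ.tsupport_subset

/-- The restriction to `D` of a function supported in `D`. -/
def toTest (ψ : SmoothCompact) (h : ψ ∈ supportedIn D) : 𝓓(D, ℝ) :=
  ⟨ψ, ψ.smooth, ψ.hasCompactSupport, h⟩

theorem inner_toL2 (u : L2 D) (ψ : SmoothCompact) :
    inner ℝ u (toL2 D ψ) = ∫ x, u x * ψ x ∂(vol D) := by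
  rw [L2.inner_def]
  refine integral_congr_ae ?_
  filter_upwards [coeFn_toL2 D ψ] with x hx
  rw [hx, real_inner_eq_re_inner, real_inner_comm]
  simp

/-! ### Weak gradients and weak Laplacians -/

/-- Pairing the vector identity with a fixed direction `e` turns it into equations between `L²`
inner products, which are visibly linear and closed in `(u, g)`. -/
theorem hasWeakGradient_iff (u : L2 D) (g : L2Vec D) :
    HasWeakGradient D u g ↔ ∀ ψ ∈ supportedIn D, ∀ e : Plane,
      inner ℝ u (toL2 D (ψ.dir e)) = - inner ℝ g (fieldL2 D e ψ) := by
  have key : ∀ ψ : SmoothCompact, ∀ e : Plane,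
      inner ℝ u (toL2 D (ψ.dir e)) = inner ℝ e (∫ x, u x • gradient ψ x ∂(vol D)) ∧
      inner ℝ g (fieldL2 D e ψ) = inner ℝ e (∫ x, ψ x • g x ∂(vol D)) := by
    intro ψ e
    constructor
    · rw [inner_toL2, ← integral_inner]
      · refine integral_congr_ae (Eventually.of_forall fun x => ?_)
        simp only [inner_smul_right, SmoothCompact.dir_apply]
        rw [real_inner_comm, inner_gradient_left]
      · exact memLp_one_iff_integrable.1
          (MemLp.smul (p := 2) (q := 2) (ψ.memLp_gradient (vol D)) (Lp.memLp u))
    · rw [L2.inner_def, ← integral_inner]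
      · refine integral_congr_ae ?_
        filter_upwards [coeFn_fieldL2 D e ψ] with x hx
        rw [hx, inner_smul_right, inner_smul_right, real_inner_comm]
      · exact memLp_one_iff_integrable.1
          (MemLp.smul (p := 2) (q := 2) (Lp.memLp g) (ψ.memLp (vol D)))
  constructor
  · intro h ψ hψ e
    have h1 := h (toTest ψ hψ)
    rw [(key ψ e).1, (key ψ e).2, ← inner_neg_right]
    exact congrArg (inner ℝ e) h1
  · intro h ψ
    refine ext_inner_left ℝ fun e => ?_
    have h1 := h _ (ofTest_mem ψ) e
    rw [(key _ e).1, (key _ e).2, ← inner_neg_right] at h1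
    exact h1

/-- The fundamental lemma of the calculus of variations. It pins down the choice made in
`weakGradient`. -/
theorem HasWeakGradient.unique {u : L2 D} {g g' : L2Vec D} (h : HasWeakGradient D u g)
    (h' : HasWeakGradient D u g') : g = g' := by
  have hint : ∀ k : L2Vec D, ∀ ψ : Plane → ℝ, ContDiff ℝ ∞ ψ → HasCompactSupport ψ →
      Integrable (fun x => ψ x • k x) (vol D) := fun k ψ h1 h2 =>
    memLp_one_iff_integrable.1 (MemLp.smul (p := 2) (q := 2) (Lp.memLp k)
      ((SmoothCompact.mk' ψ h1 h2).memLp (vol D)))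
  have hloc : LocallyIntegrableOn (fun x => g x - g' x) D volume := by
    have h1 : LocallyIntegrable (fun x => g x - g' x) (vol D) :=
      ((Lp.memLp g).sub (Lp.memLp g')).locallyIntegrable (by norm_num)
    exact locallyIntegrableOn_of_locallyIntegrable_restrict h1
  have hz := D.isOpen.ae_eq_zero_of_integral_contDiff_smul_eq_zero hloc (by
    intro ψ h1 h2 h3
    have e1 := h ⟨ψ, h1, h2, h3⟩
    have e2 := h' ⟨ψ, h1, h2, h3⟩
    have e3 : ∫ x, ψ x • g x ∂(vol D) = ∫ x, ψ x • g' x ∂(vol D) := neg_injective (e1.symm.trans e2)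
    rw [← setIntegral_eq_integral_of_forall_compl_eq_zero (s := (D : Set Plane))]
    · simp only [smul_sub]
      rw [integral_sub (hint g ψ h1 h2) (hint g' ψ h1 h2), e3, sub_self]
    · intro x hx
      rw [image_eq_zero_of_notMem_tsupport fun hx' => hx (h3 hx'), zero_smul])
  apply Lp.ext
  rw [EventuallyEq, ae_restrict_iff' D.isOpen.measurableSet]
  filter_upwards [hz] with x hx hxD using sub_eq_zero.1 (hx hxD)

theorem weakGradient_eq {u : L2 D} {g : L2Vec D} (h : HasWeakGradient D u g) :
    weakGradient D u = g :=
  HasWeakGradient.unique (Classical.epsilon_spec (p := HasWeakGradient D u) ⟨g, h⟩) h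

theorem dirichletEnergy_eq (u : L2 D) : dirichletEnergy D u = ‖weakGradient D u‖ ^ 2 := by
  rw [← real_inner_self_eq_norm_sq, L2.inner_def]
  simp only [real_inner_self_eq_norm_sq]
  rfl

variable (D) in
/-- The pairs `(u, ∇u)`, `u ∈ H¹(D)`. -/
def weakGradientGraph : Submodule ℝ (WithLp 2 (L2 D × L2Vec D)) where
  carrier := {z | HasWeakGradient D z.fst z.snd}
  add_mem' {z z'} h h' := by
    simp only [Set.mem_ofPred_eq, hasWeakGradient_iff] at *
    intro ψ hψ e
    simp only [WithLp.add_fst, WithLp.add_snd, inner_add_left, h ψ hψ e, h' ψ hψ e]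
    ring
  zero_mem' := by
    simp [hasWeakGradient_iff]
  smul_mem' c z h := by
    simp only [Set.mem_ofPred_eq, hasWeakGradient_iff] at *
    intro ψ hψ e
    simp only [WithLp.smul_fst, WithLp.smul_snd, inner_smul_left, h ψ hψ e]
    simp

theorem mem_weakGradientGraph {z : WithLp 2 (L2 D × L2Vec D)} :
    z ∈ weakGradientGraph D ↔ HasWeakGradient D z.fst z.snd := Iff.rfl

theorem HasWeakGradient.add {u u' : L2 D} {g g' : L2Vec D} (h : HasWeakGradient D u g)
    (h' : HasWeakGradient D u' g') : HasWeakGradient D (u + u') (g + g') :=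
  (weakGradientGraph D).add_mem (x := .toLp 2 (u, g)) (y := .toLp 2 (u', g')) h h'

theorem HasWeakGradient.smul {u : L2 D} {g : L2Vec D} (c : ℝ) (h : HasWeakGradient D u g) :
    HasWeakGradient D (c • u) (c • g) :=
  (weakGradientGraph D).smul_mem (x := .toLp 2 (u, g)) c h

theorem isClosed_weakGradientGraph :
    IsClosed (weakGradientGraph D : Set (WithLp 2 (L2 D × L2Vec D))) := by
  have : (weakGradientGraph D : Set (WithLp 2 (L2 D × L2Vec D))) =
      ⋂ ψ ∈ supportedIn D, ⋂ e : Plane, {z | inner ℝ z.fst (toL2 D (ψ.dir e)) =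
        - inner ℝ z.snd (fieldL2 D e ψ)} := by
    ext z
    simp only [SetLike.mem_coe, mem_weakGradientGraph, hasWeakGradient_iff, Set.mem_iInter,
      Set.mem_ofPred_eq]
  rw [this]
  have c1 : Continuous fun z : WithLp 2 (L2 D × L2Vec D) => z.fst :=
    (WithLp.fstL 2 ℝ (L2 D) (L2Vec D)).continuous
  have c2 : Continuous fun z : WithLp 2 (L2 D × L2Vec D) => z.snd :=
    (WithLp.sndL 2 ℝ (L2 D) (L2Vec D)).continuous
  refine isClosed_biInter fun ψ _ => isClosed_iInter fun e => isClosed_eq ?_ ?_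
  · exact c1.inner continuous_const
  · exact (c2.inner continuous_const).neg

/-- `χ` need not vanish on the boundary of `D`: the test function is supported in `D`, so both
integrals extend to the plane, where integration by parts has no boundary term. -/
theorem hasWeakGradient_toL2 (χ : SmoothCompact) :
    HasWeakGradient D (toL2 D χ) (gradL2 D χ) := by
  rw [hasWeakGradient_iff]
  intro ψ hψ e
  have e1 : inner ℝ (gradL2 D χ) (fieldL2 D e ψ) = ∫ x, fderiv ℝ χ x e * ψ x ∂(vol D) := by
    rw [L2.inner_def]
    refine integral_congr_ae ?_
    filter_upwards [coeFn_gradL2 D χ, coeFn_fieldL2 D e ψ] with x h1 h2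
    rw [h1, h2, inner_smul_right, inner_gradient_left, mul_comm]
  have e2 : inner ℝ (toL2 D χ) (toL2 D (ψ.dir e)) = ∫ x, χ x * fderiv ℝ ψ x e ∂(vol D) := by
    rw [inner_toL2]
    refine integral_congr_ae ?_
    filter_upwards [coeFn_toL2 D χ] with x h1
    rw [h1, SmoothCompact.dir_apply]
  have hint : ∀ f h : SmoothCompact, Integrable (fun x => f x * h x) (volume : Measure Plane) :=
    fun f h => (f.memLp volume).integrable_mul (h.memLp volume)
  have hD : ∀ f : Plane → ℝ, ∀ h : SmoothCompact, h ∈ supportedIn D →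
      ∫ x, f x * h x ∂(vol D) = ∫ x, f x * h x := by
    intro f h hh
    refine setIntegral_eq_integral_of_forall_compl_eq_zero fun x hx => ?_
    rw [image_eq_zero_of_notMem_tsupport fun hx' => hx (hh hx'), mul_zero]
  rw [e1, e2, hD _ ψ hψ]
  refine (hD χ (ψ.dir e) (dir_mem_supportedIn hψ e)).trans ?_
  exact integral_mul_fderiv_eq_neg_fderiv_mul_of_integrable (hint (χ.dir e) ψ) (hint χ (ψ.dir e))
    (hint χ ψ) (fun x _ => χ.differentiable x) (fun x _ => ψ.differentiable x)

theorem gradL2_eq_sum (ψ : SmoothCompact) {ι : Type*} [Fintype ι]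
    (b : OrthonormalBasis ι ℝ Plane) : gradL2 D ψ = ∑ i, fieldL2 D (b i) (ψ.dir (b i)) := by
  apply Lp.ext
  have h2 : ∀ᵐ x ∂(vol D), ∀ i, fieldL2 D (b i) (ψ.dir (b i)) x = ψ.dir (b i) x • b i :=
    ae_all_iff.2 fun i => coeFn_fieldL2 D (b i) (ψ.dir (b i))
  filter_upwards [coeFn_gradL2 D ψ, h2,
    Lp.coeFn_fun_finsetSum Finset.univ fun i => fieldL2 D (b i) (ψ.dir (b i))] with x h1 h2 h3
  rw [h1, h3]
  simp only [h2]
  rw [← b.sum_repr (gradient ψ x)]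
  refine Finset.sum_congr rfl fun i _ => ?_
  rw [b.repr_apply_apply, SmoothCompact.dir_apply, real_inner_comm, inner_gradient_left]

/-- The Laplacian is a sum of second derivatives along an orthonormal basis; the weak gradient
identity is applied with the first derivatives of `ψ` as test functions. -/
theorem integral_mul_laplacian {u : L2 D} {g : L2Vec D} (h : HasWeakGradient D u g)
    {ψ : SmoothCompact} (hψ : ψ ∈ supportedIn D) :
    ∫ x, u x * Laplacian.laplacian (ψ : Plane → ℝ) x ∂(vol D) = - inner ℝ g (gradL2 D ψ) := by
  let b := EuclideanSpace.basisFun (Fin 2) ℝ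
  rw [gradL2_eq_sum ψ b, inner_sum, ← Finset.sum_neg_distrib]
  simp only [← (hasWeakGradient_iff u g).1 h _ (dir_mem_supportedIn hψ _) _, inner_toL2]
  rw [← integral_finsetSum]
  · refine integral_congr_ae (Eventually.of_forall fun x => ?_)
    rw [InnerProductSpace.laplacian_eq_iteratedFDeriv_orthonormalBasis _ b]
    simp only [Finset.mul_sum]
    refine Finset.sum_congr rfl fun i _ => ?_
    rw [iteratedFDeriv_two_apply, SmoothCompact.dir_apply]
    congr 1
    have hd : DifferentiableAt ℝ (fderiv ℝ ψ) x :=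
      (ψ.smooth.fderiv_right (m := 1) (by norm_cast)).differentiable one_ne_zero x
    have : fderiv ℝ (ψ.dir (b i)) x = (fderiv ℝ (fderiv ℝ ψ) x).flip (b i) :=
      fderiv_clm_apply hd (differentiableAt_const _) |>.trans (by simp)
    rw [this]
    simp
  · intro i _
    exact (Lp.memLp u).integrable_mul (((ψ.dir (b i)).dir (b i)).memLp (vol D))

theorem HasWeakGradient.hasWeakLaplacian_iff {u : L2 D} {g : L2Vec D}
    (h : HasWeakGradient D u g) (f : L2 D) :
    HasWeakLaplacian D u f ↔
      ∀ ψ ∈ supportedIn D, inner ℝ g (gradL2 D ψ) = - inner ℝ f (toL2 D ψ) := by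
  constructor
  · intro hf ψ hψ
    rw [inner_toL2, eq_neg_iff_add_eq_zero, add_comm, ← eq_neg_iff_add_eq_zero,
      ← integral_mul_laplacian h hψ]
    exact (hf (toTest ψ hψ)).symm
  · intro hf ψ
    have h1 := hf _ (ofTest_mem ψ)
    rw [inner_toL2] at h1
    exact (integral_mul_laplacian h (ofTest_mem ψ)).trans (by rw [h1, neg_neg]; rfl)

/-! ### The space `H¹₀` as a closed subspace -/

variable (D) in
/-- The map `ψ ↦ (ψ, ∇ψ)`. -/
def jet : SmoothCompact →ₗ[ℝ] WithLp 2 (L2 D × L2Vec D) where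
  toFun ψ := .toLp 2 (toL2 D ψ, gradL2 D ψ)
  map_add' _ _ := by simp only [map_add]; rfl
  map_smul' _ _ := by simp only [map_smul]; rfl

variable (D) in
/-- The closure of the pairs `(ψ, ∇ψ)`, `ψ ∈ C_c^∞(D)`. -/
def sobolevZero : Submodule ℝ (WithLp 2 (L2 D × L2Vec D)) :=
  ((supportedIn D).map (jet D)).topologicalClosure

theorem sobolevZero_le : sobolevZero D ≤ weakGradientGraph D := by
  refine Submodule.topologicalClosure_minimal _ ?_ isClosed_weakGradientGraph
  rintro _ ⟨ψ, -, rfl⟩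
  exact hasWeakGradient_toL2 ψ

/-- A closed property holds on `sobolevZero D` if it holds for test functions. -/
theorem sobolevZero_induction {p : WithLp 2 (L2 D × L2Vec D) → Prop}
    (hp : IsClosed {z | p z}) (h : ∀ ψ ∈ supportedIn D, p (jet D ψ))
    {z : WithLp 2 (L2 D × L2Vec D)} (hz : z ∈ sobolevZero D) : p z := by
  have hz' : z ∈ closure ((supportedIn D).map (jet D) : Set (WithLp 2 (L2 D × L2Vec D))) := hz
  refine closure_minimal ?_ hp hz'
  rintro _ ⟨ψ, hψ, rfl⟩
  exact h ψ hψ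

theorem jet_mem_sobolevZero {ψ : SmoothCompact} (hψ : ψ ∈ supportedIn D) :
    jet D ψ ∈ sobolevZero D :=
  subset_closure ⟨ψ, hψ, rfl⟩

theorem tendsto_toL2_iff (ψ : ℕ → SmoothCompact) (u : L2 D) :
    Tendsto (fun n => toL2 D (ψ n)) atTop (𝓝 u) ↔
      Tendsto (fun n => eLpNorm (fun x => u x - ψ n x) 2 (vol D)) atTop (𝓝 0) := by
  rw [Lp.tendsto_Lp_iff_tendsto_eLpNorm']
  refine iff_of_eq (congrArg (Tendsto · atTop (𝓝 0)) (funext fun n => ?_))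
  rw [eLpNorm_sub_comm]
  refine eLpNorm_congr_ae ?_
  filter_upwards [coeFn_toL2 D (ψ n)] with x hx
  rw [Pi.sub_apply, hx]

theorem tendsto_gradL2_iff (ψ : ℕ → SmoothCompact) (g : L2Vec D) :
    Tendsto (fun n => gradL2 D (ψ n)) atTop (𝓝 g) ↔
      Tendsto (fun n => eLpNorm (fun x => g x - gradient (ψ n) x) 2 (vol D)) atTop (𝓝 0) := by
  rw [Lp.tendsto_Lp_iff_tendsto_eLpNorm']
  refine iff_of_eq (congrArg (Tendsto · atTop (𝓝 0)) (funext fun n => ?_))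
  rw [eLpNorm_sub_comm]
  refine eLpNorm_congr_ae ?_
  filter_upwards [coeFn_gradL2 D (ψ n)] with x hx
  rw [Pi.sub_apply, hx]

/-- In a metric space closure points are sequential limits. The weak gradient condition in `H10`
comes for free from `sobolevZero_le`. -/
theorem mem_H10_iff (v : L2 D) : v ∈ H10 D ↔ ∃ g, WithLp.toLp 2 (v, g) ∈ sobolevZero D := by
  constructor
  · rintro ⟨g, -, ψ, h1, h2⟩
    refine ⟨g, mem_closure_of_tendsto (f := fun n => jet D (ofTest (ψ n))) (b := atTop) ?_
      (Eventually.of_forall fun n => ⟨_, ofTest_mem (ψ n), rfl⟩)⟩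
    exact ((WithLp.prodContinuousLinearEquiv 2 ℝ (L2 D) (L2Vec D)).symm.continuous.tendsto
      (v, g)).comp (((tendsto_toL2_iff (fun n => ofTest (ψ n)) v).2 h1).prodMk_nhds
        ((tendsto_gradL2_iff (fun n => ofTest (ψ n)) g).2 h2))
  · rintro ⟨g, hg⟩
    obtain ⟨z, hz, hlim⟩ := mem_closure_iff_seq_limit.1 hg
    choose ψ hψ hψz using hz
    obtain rfl : z = fun n => jet D (ψ n) := funext fun n => (hψz n).symm
    refine ⟨g, sobolevZero_le hg, fun n => toTest (ψ n) (hψ n), ?_, ?_⟩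
    · exact (tendsto_toL2_iff ψ v).1
        (((WithLp.fstL 2 ℝ (L2 D) (L2Vec D)).continuous.tendsto _).comp hlim)
    · exact (tendsto_gradL2_iff ψ g).1
        (((WithLp.sndL 2 ℝ (L2 D) (L2Vec D)).continuous.tendsto _).comp hlim)

end TestFunctions

/-! ### A Poincaré inequality -/

section Poincare

variable (D : TopologicalSpace.Opens Plane)

/-- The smooth compactly supported functions whose differential vanishes off `D`. -/
def flatOff : Submodule ℝ SmoothCompact where
  carrier := {ψ | ∀ x ∉ D, fderiv ℝ ψ x = 0}
  add_mem' {ψ χ} h h' x hx := by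
    refine (fderiv_add (ψ.differentiable x) (χ.differentiable x)).trans ?_
    rw [h x hx, h' x hx, add_zero]
  zero_mem' x _ := fderiv_const_apply (0 : ℝ)
  smul_mem' c ψ h x hx := by
    refine (fderiv_const_smul (ψ.differentiable x) c).trans ?_
    rw [h x hx, smul_zero]

variable {D}

theorem supportedIn_le_flatOff : supportedIn D ≤ flatOff D := fun _ hψ _ hx =>
  image_eq_zero_of_notMem_tsupport fun h => hx (hψ (tsupport_fderiv_subset ℝ h))

theorem eLpNorm_eq_eLpNorm_vol {F : Type*} [NormedAddCommGroup F] {f : Plane → F}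
    (hf : Function.support f ⊆ (D : Set Plane)) (p : ℝ≥0∞) :
    eLpNorm f p volume = eLpNorm f p (vol D) :=
  (eLpNorm_restrict_eq_of_support_subset hf).symm

/-- The Gagliardo–Nirenberg–Sobolev inequality with exponent `1` in dimension `2` bounds the `L²`
norm by the `L¹` norm of the differential. The differential lives on `D`, whose finite measure
converts `L¹` to `L²`. The left side is a norm over the whole plane, so it also sees the values of
`ψ` off `D`. -/
theorem exists_eLpNorm_le (hD : volume (D : Set Plane) ≠ ⊤) :
    ∃ C : ℝ, 0 ≤ C ∧ ∀ ψ ∈ flatOff D,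
      eLpNorm ψ 2 volume ≤ ENNReal.ofReal (C * ‖gradL2 D ψ‖) := by
  have hconj : NNReal.HolderConjugate (Module.finrank ℝ Plane) 2 := by
    rw [finrank_euclideanSpace_fin]
    exact_mod_cast NNReal.HolderConjugate.two_two
  obtain ⟨K, hK⟩ : ∃ K : NNReal, ∀ f : Plane → ℝ, ContDiff ℝ 1 f → HasCompactSupport f →
      eLpNorm f 2 volume ≤ K * eLpNorm (fderiv ℝ f) 1 volume :=
    ⟨_, fun f hf hc => eLpNorm_le_eLpNorm_fderiv_one volume hf hc hconj⟩
  set m := volume (D : Set Plane) ^ (1 / 2 : ℝ) with hm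
  have hm' : m ≠ ⊤ := ENNReal.rpow_ne_top_of_nonneg (by norm_num) hD
  refine ⟨K * m.toReal, by positivity, fun ψ hψ => ?_⟩
  have h1 := hK ψ (ψ.smooth.of_le (by norm_cast)) ψ.hasCompactSupport
  have h2 : eLpNorm (fderiv ℝ ψ) 1 volume = eLpNorm (fderiv ℝ ψ) 1 (vol D) := by
    have hs : Function.support (fderiv ℝ ψ) ⊆ (D : Set Plane) := fun x hx => by
      by_contra h
      exact hx (hψ x h)
    exact eLpNorm_eq_eLpNorm_vol hs 1
  have h3 : eLpNorm (fderiv ℝ ψ) 1 (vol D) ≤ eLpNorm (fderiv ℝ ψ) 2 (vol D) * m := by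
    refine (eLpNorm_le_eLpNorm_mul_rpow_measure_univ (p := 1) (q := 2) (by norm_num)
      ψ.continuous_fderiv.aestronglyMeasurable).trans (le_of_eq ?_)
    rw [Measure.restrict_apply_univ, hm]
    norm_num
  have h4 : eLpNorm (fderiv ℝ ψ) 2 (vol D) = ENNReal.ofReal ‖gradL2 D ψ‖ := by
    have e1 : eLpNorm (fderiv ℝ ψ) 2 (vol D) = eLpNorm (gradient ψ) 2 (vol D) :=
      eLpNorm_congr_norm_ae (Eventually.of_forall fun x => by
        rw [gradient, LinearIsometryEquiv.norm_map])
    rw [e1, gradL2]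
    change _ = ENNReal.ofReal ‖(ψ.memLp_gradient (vol D)).toLp (gradient ψ)‖
    rw [Lp.norm_toLp, ENNReal.ofReal_toReal (ψ.memLp_gradient (vol D)).eLpNorm_ne_top]
  calc eLpNorm ψ 2 volume ≤ K * (ENNReal.ofReal ‖gradL2 D ψ‖ * m) := by
        rw [← h4]
        refine h1.trans ?_
        rw [h2]
        gcongr
    _ = ENNReal.ofReal (K * m.toReal * ‖gradL2 D ψ‖) := by
        rw [ENNReal.ofReal_mul (by positivity), ENNReal.ofReal_mul (by positivity),
          ENNReal.ofReal_toReal hm', ENNReal.ofReal_coe_nnreal]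
        ring

/-- The Poincaré inequality for `v + χ`, `v ∈ H¹₀(D)`, where `χ` is smooth and locally constant off
`D`; the constants attained by `χ` off `D` are controlled as well. -/
theorem exists_poincare (hD : volume (D : Set Plane) ≠ ⊤) :
    ∃ C : ℝ, 0 ≤ C ∧ ∀ χ ∈ flatOff D, ∀ z ∈ sobolevZero D,
      ‖z.fst + toL2 D χ‖ ≤ C * ‖z.snd + gradL2 D χ‖ ∧
      ∀ A : Set Plane, MeasurableSet A → Disjoint A D → ∀ θ : ℝ, (∀ x ∈ A, χ x = θ) →
        |θ| * (volume A ^ (1 / 2 : ℝ)).toReal ≤ C * ‖z.snd + gradL2 D χ‖ := by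
  obtain ⟨C, hC, h⟩ := exists_eLpNorm_le hD
  have c1 : Continuous fun z : WithLp 2 (L2 D × L2Vec D) => z.fst :=
    (WithLp.fstL 2 ℝ (L2 D) (L2Vec D)).continuous
  have c2 : Continuous fun z : WithLp 2 (L2 D × L2Vec D) => z.snd :=
    (WithLp.sndL 2 ℝ (L2 D) (L2Vec D)).continuous
  refine ⟨C, hC, fun χ hχ z hz => ⟨?_, fun A hA hAD θ hθ => ?_⟩⟩
  · refine sobolevZero_induction (p := fun z : WithLp 2 (L2 D × L2Vec D) =>
      ‖z.fst + toL2 D χ‖ ≤ C * ‖z.snd + gradL2 D χ‖)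
      (isClosed_le (c1.add continuous_const).norm
        (continuous_const.mul (c2.add continuous_const).norm)) (fun ψ hψ => ?_) hz
    change ‖(toL2 D ψ + toL2 D χ : L2 D)‖ ≤ C * ‖(gradL2 D ψ + gradL2 D χ : L2Vec D)‖
    rw [← map_add, ← map_add]
    have h1 := h _ ((flatOff D).add_mem (supportedIn_le_flatOff hψ) hχ)
    change ‖((ψ + χ).memLp (vol D)).toLp (ψ + χ : SmoothCompact)‖ ≤ _
    rw [Lp.norm_toLp]
    exact ENNReal.toReal_le_of_le_ofReal (by positivity)
      ((eLpNorm_mono_measure _ Measure.restrict_le_self).trans h1)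
  · refine sobolevZero_induction (p := fun z : WithLp 2 (L2 D × L2Vec D) =>
      |θ| * (volume A ^ (1 / 2 : ℝ)).toReal ≤
      C * ‖z.snd + gradL2 D χ‖) (isClosed_le continuous_const
        (continuous_const.mul (c2.add continuous_const).norm)) (fun ψ hψ => ?_) hz
    change _ ≤ C * ‖(gradL2 D ψ + gradL2 D χ : L2Vec D)‖
    rw [← map_add]
    have h1 := h _ ((flatOff D).add_mem (supportedIn_le_flatOff hψ) hχ)
    -- On `A` the test function `ψ` vanishes, so only the constant `θ` remains there.
    have h2 : eLpNorm (ψ + χ : SmoothCompact) 2 (volume.restrict A) =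
        ‖θ‖ₑ * volume A ^ (1 / 2 : ℝ) := by
      by_cases h0 : volume A = 0
      · rw [Measure.restrict_eq_zero.2 h0, h0, eLpNorm_measure_zero,
          ENNReal.zero_rpow_of_pos (by norm_num), mul_zero]
      · rw [eLpNorm_congr_ae (g := fun _ => θ), eLpNorm_const _ (by norm_num)
          (by rwa [Ne, Measure.restrict_eq_zero]), Measure.restrict_apply_univ]
        · norm_num
        · filter_upwards [ae_restrict_mem hA] with x hx
          have : ψ x = 0 := image_eq_zero_of_notMem_tsupport fun hx' =>
            Set.disjoint_left.1 hAD hx (hψ hx')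
          change ψ x + χ x = θ
          rw [this, hθ x hx, zero_add]
    have h3 := ENNReal.toReal_le_of_le_ofReal (by positivity)
      (h2 ▸ (eLpNorm_mono_measure _ Measure.restrict_le_self).trans h1)
    rwa [ENNReal.toReal_mul, toReal_enorm, Real.norm_eq_abs] at h3

/-! ### Solvability of the Dirichlet problem -/

/-- Weak solvability in `H¹₀(D)` of `-Δ v = φ - div k`. -/
theorem exists_weak_solution (hD : volume (D : Set Plane) ≠ ⊤) (φ : L2 D) (k : L2Vec D) :
    ∃ z ∈ sobolevZero D, ∀ w ∈ sobolevZero D,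
      inner ℝ z.snd w.snd = inner ℝ φ w.fst + inner ℝ k w.snd := by
  obtain ⟨C, hC, hP⟩ := exists_poincare hD
  have hP' : ∀ z ∈ sobolevZero D, ‖z.fst‖ ≤ C * ‖z.snd‖ := fun z hz => by
    simpa using (hP 0 (zero_mem _) z hz).1
  have : IsClosed (sobolevZero D : Set (WithLp 2 (L2 D × L2Vec D))) :=
    Submodule.isClosed_topologicalClosure _
  have : CompleteSpace (sobolevZero D) := this.completeSpace_coe
  let G : sobolevZero D →L[ℝ] L2Vec D :=
    (WithLp.sndL 2 ℝ (L2 D) (L2Vec D)).comp (sobolevZero D).subtypeL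
  let B : sobolevZero D →L[ℝ] sobolevZero D →L[ℝ] ℝ := (innerSL ℝ).bilinearComp G G
  have hB : ∀ z w, B z w = inner ℝ z.1.snd w.1.snd := fun z w => rfl
  have hco : IsCoercive B := by
    -- Poincaré bounds the full `H¹` norm: `‖z‖² ≤ (C² + 1) ‖z.snd‖²`.
    refine ⟨(1 + C ^ 2)⁻¹, by positivity, fun z => ?_⟩
    rw [hB, real_inner_self_eq_norm_sq]
    have h1 : ‖z‖ ^ 2 = ‖z.1.fst‖ ^ 2 + ‖z.1.snd‖ ^ 2 := WithLp.prod_norm_sq_eq_of_L2 z.1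
    have h2 : ‖z.1.fst‖ ^ 2 ≤ (C * ‖z.1.snd‖) ^ 2 := by
      gcongr
      exact hP' z.1 z.2
    rw [mul_assoc, ← sq, inv_mul_le_iff₀ (by positivity), h1]
    linarith
  -- On `sobolevZero D` the right-hand side is the inner product with `(φ, k)`, hence with its
  -- orthogonal projection; Lax–Milgram then applies.
  let y := (sobolevZero D).orthogonalProjectionOnto (.toLp 2 (φ, k))
  refine ⟨hco.continuousLinearEquivOfBilin.symm y, Subtype.mem _, fun w hw => ?_⟩
  have h1 := hco.continuousLinearEquivOfBilin_apply (hco.continuousLinearEquivOfBilin.symm y)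
    ⟨w, hw⟩
  rw [ContinuousLinearEquiv.apply_symm_apply, hB,
    Submodule.inner_orthogonalProjectionOnto_eq_of_mem_right] at h1
  exact h1.symm

/-- Existence is what validates the choice in `green`. Uniqueness is never needed: the argument uses
only these two properties. -/
theorem green_spec (hD : volume (D : Set Plane) ≠ ⊤) (φ : L2 D) :
    green D φ ∈ H10 D ∧ HasWeakLaplacian D (green D φ) (-φ) := by
  refine Classical.epsilon_spec (p := fun w => w ∈ H10 D ∧ HasWeakLaplacian D w (-φ)) ?_
  obtain ⟨z, hz, h⟩ := exists_weak_solution hD φ 0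
  refine ⟨z.fst, (mem_H10_iff _).2 ⟨z.snd, hz⟩, ?_⟩
  rw [(sobolevZero_le hz : HasWeakGradient D z.fst z.snd).hasWeakLaplacian_iff]
  intro ψ hψ
  have := h _ (jet_mem_sobolevZero hψ)
  rw [inner_zero_left, add_zero] at this
  rw [inner_neg_left, neg_neg]
  exact this

/-- The weak formulation of `Δ u = f` against `H¹₀(D)`. -/
theorem HasWeakLaplacian.inner_eq {u f : L2 D} {g : L2Vec D} (h : HasWeakLaplacian D u f)
    (hg : HasWeakGradient D u g) {w : WithLp 2 (L2 D × L2Vec D)} (hw : w ∈ sobolevZero D) :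
    inner ℝ g w.snd = - inner ℝ f w.fst := by
  refine sobolevZero_induction (p := fun w => inner ℝ g w.snd = - inner ℝ f w.fst) ?_
    ((hg.hasWeakLaplacian_iff f).1 h) hw
  exact isClosed_eq
    (continuous_const.inner (WithLp.sndL 2 ℝ (L2 D) (L2Vec D)).continuous)
    (continuous_const.inner (WithLp.fstL 2 ℝ (L2 D) (L2Vec D)).continuous).neg

end Poincare

namespace MultiplyConnected

variable {N : ℕ} (M : MultiplyConnected N)

/-! ### The geometry of the domain -/

theorem mem_domain {x : Plane} : x ∈ M.domain ↔ x ∈ M.outer ∧ ∀ j, x ∉ closure (M.hole j) := by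
  change x ∈ M.outer \ ⋃ i, closure (M.hole i) ↔ _
  simp

theorem volume_domain_ne_top : volume (M.domain : Set Plane) ≠ ⊤ :=
  (M.outer_smooth.isBounded.subset Set.sdiff_subset).measure_lt_top.ne

/-- Otherwise `outer` would be a finite union of closed sets, hence clopen and nonempty in the
connected plane, contradicting boundedness. -/
theorem domain_nonempty : (M.domain : Set Plane).Nonempty := by
  by_contra h
  have heq : M.outer = ⋃ i, closure (M.hole i) := by
    refine (Set.sdiff_eq_empty.1 (Set.not_nonempty_iff_eq_empty.1 h)).antisymm ?_
    exact Set.iUnion_subset M.hole_subset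
  have hcl : IsClosed M.outer := by
    rw [heq]
    exact isClosed_iUnion_of_finite fun _ => isClosed_closure
  have huniv := IsClopen.eq_univ ⟨hcl, M.outer_smooth.isOpen⟩
    M.outer_smooth.simplyConnected.nonempty
  exact NormedSpace.unbounded_univ ℝ Plane (huniv ▸ M.outer_smooth.isBounded)

theorem eq_of_mem_closure {i j : Fin N} {x : Plane} (hi : x ∈ closure (M.hole i))
    (hj : x ∈ closure (M.hole j)) : i = j := by
  by_contra h
  exact Set.disjoint_left.1 (M.hole_disjoint i j h) hi hj

theorem exists_cutoff (i : Fin N) : ∃ χ : Plane → ℝ, ContDiff ℝ ∞ χ ∧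
    (∀ᶠ x in 𝓝ˢ (frontier M.outer), χ x = 0) ∧
    (∀ j, ∀ᶠ x in 𝓝ˢ (frontier (M.hole j)), χ x = if j = i then 1 else 0) := by
  let s : Set Plane := M.outerᶜ ∪ ⋃ j : {j : Fin N // j ≠ i}, closure (M.hole j)
  have hsc : IsClosed s := M.outer_smooth.isOpen.isClosed_compl.union
    (isClosed_iUnion_of_finite fun _ => isClosed_closure)
  have hd : Disjoint s (closure (M.hole i)) := by
    rw [Set.disjoint_left]
    rintro x (hx | hx) hi
    · exact hx (M.hole_subset i hi)
    · obtain ⟨⟨j, hj⟩, hx⟩ := Set.mem_iUnion.1 hx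
      exact hj (M.eq_of_mem_closure hx hi)
  obtain ⟨f, hf, h0, h1⟩ : ∃ f : Plane → ℝ, ContDiff ℝ ∞ f ∧ (∀ᶠ x in 𝓝ˢ s, f x = 0) ∧
      (∀ᶠ x in 𝓝ˢ (closure (M.hole i)), f x = 1) := by
    obtain ⟨f, h0, h1, -⟩ := exists_contMDiffMap_zero_one_nhds_of_isClosed
      (modelWithCornersSelf ℝ Plane) (n := ⊤) hsc isClosed_closure hd
    exact ⟨f, f.contMDiff.contDiff, h0, h1⟩
  refine ⟨f, hf, ?_, fun j => ?_⟩
  · refine h0.filter_mono (nhdsSet_mono fun x hx => Or.inl ?_)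
    rw [M.outer_smooth.isOpen.frontier_eq] at hx
    exact hx.2
  · by_cases hj : j = i
    · simp only [hj, if_true]
      exact h1.filter_mono (nhdsSet_mono frontier_subset_closure)
    · have hsub : closure (M.hole j) ⊆ s :=
        (Set.subset_iUnion (fun k : {j : Fin N // j ≠ i} => closure (M.hole k)) ⟨j, hj⟩).trans
          Set.subset_union_right
      simp only [hj, if_false]
      exact h0.filter_mono (nhdsSet_mono (frontier_subset_closure.trans hsub))

/-- A function that is constant near each boundary component extends to the plane, by `1` on the
`i`-th hole and by `0` on the other holes and off the outer domain. -/
theorem exists_extension {i : Fin N} {χ : Plane → ℝ} (hχ : ContDiff ℝ ∞ χ)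
    (h0 : ∀ᶠ x in 𝓝ˢ (frontier M.outer), χ x = 0)
    (h1 : ∀ j, ∀ᶠ x in 𝓝ˢ (frontier (M.hole j)), χ x = if j = i then 1 else 0) :
    ∃ Ψ ∈ flatOff M.domain, (∀ x ∈ M.domain, Ψ x = χ x) ∧
      ∀ j, ∀ x ∈ M.hole j, Ψ x = if j = i then 1 else 0 := by
  classical
  -- Away from the boundary components `χ` is uncontrolled inside the holes and outside `outer`, so
  -- it is overwritten there by the constants it takes near the boundary.
  let f : Plane → ℝ := fun x => if x ∈ M.outer then
    if ∃ j, x ∈ closure (M.hole j) then if x ∈ closure (M.hole i) then 1 else 0 else χ x else 0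
  have fD : ∀ x ∈ M.domain, f x = χ x := by
    intro x hx
    rw [mem_domain] at hx
    simp [f, hx.1, hx.2]
  have fK : ∀ j, ∀ x ∈ closure (M.hole j), f x = if j = i then 1 else 0 := by
    intro j x hx
    have hex : ∃ j, x ∈ closure (M.hole j) := ⟨j, hx⟩
    simp only [f, M.hole_subset j hx, hex, if_true]
    by_cases hj : j = i
    · simp [← hj, hx]
    · have hi : x ∉ closure (M.hole i) := fun h => hj (M.eq_of_mem_closure hx h)
      simp [hj, hi]
  have fO : ∀ x ∉ M.outer, f x = 0 := fun x hx => by simp [f, hx]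
  -- Local constancy at every point off `D`, including boundary points, yields both smoothness of
  -- the glued function and the vanishing of its differential.
  have flat : ∀ x ∉ M.domain, ∃ c : ℝ, f =ᶠ[𝓝 x] fun _ => c := by
    intro x hx
    by_cases hxo : x ∈ M.outer
    · obtain ⟨j, hj⟩ : ∃ j, x ∈ closure (M.hole j) := by
        by_contra! h
        exact hx (M.mem_domain.2 ⟨hxo, h⟩)
      refine ⟨if j = i then 1 else 0, ?_⟩
      have hev : ∀ᶠ y in 𝓝 x, y ∈ closure (M.hole j) ∨ χ y = if j = i then 1 else 0 := by
        by_cases hxj : x ∈ M.hole j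
        · filter_upwards [(M.hole_smooth j).isOpen.mem_nhds hxj] with y hy
          exact Or.inl (subset_closure hy)
        · have : x ∈ frontier (M.hole j) := by
            rw [(M.hole_smooth j).isOpen.frontier_eq]
            exact ⟨hj, hxj⟩
          exact ((h1 j).filter_mono (nhds_le_nhdsSet this)).mono fun y hy => Or.inr hy
      have hout : ∀ᶠ y in 𝓝 x, ∀ k, k ≠ j → y ∉ closure (M.hole k) := by
        refine eventually_all.2 fun k => ?_
        by_cases hk : k = j
        · simp [hk]
        · filter_upwards [isClosed_closure.isOpen_compl.mem_nhds
            (fun h => hk (M.eq_of_mem_closure h hj) : x ∈ (closure (M.hole k))ᶜ)] with y hy _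
          exact hy
      filter_upwards [hev, hout, M.outer_smooth.isOpen.mem_nhds hxo] with y hy1 hy2 hy3
      by_cases hyj : y ∈ closure (M.hole j)
      · exact fK j y hyj
      · rw [fD y (M.mem_domain.2 ⟨hy3, fun k => ?_⟩)]
        · exact hy1.resolve_left hyj
        · by_cases hk : k = j
          · rwa [hk]
          · exact hy2 k hk
    · refine ⟨0, ?_⟩
      by_cases hxc : x ∈ closure M.outer
      · have : x ∈ frontier M.outer := by
          rw [M.outer_smooth.isOpen.frontier_eq]
          exact ⟨hxc, hxo⟩
        have hout : ∀ᶠ y in 𝓝 x, ∀ k, y ∉ closure (M.hole k) :=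
          eventually_all.2 fun k => isClosed_closure.isOpen_compl.mem_nhds
            (fun h => hxo (M.hole_subset k h))
        filter_upwards [h0.filter_mono (nhds_le_nhdsSet this), hout] with y hy1 hy2
        by_cases hyo : y ∈ M.outer
        · rw [fD y (M.mem_domain.2 ⟨hyo, hy2⟩), hy1]
        · exact fO y hyo
      · filter_upwards [isClosed_closure.isOpen_compl.mem_nhds hxc] with y hy
        exact fO y fun h => hy (subset_closure h)
  have smooth : ContDiff ℝ ∞ f := by
    rw [contDiff_iff_contDiffAt]
    intro x
    by_cases hx : x ∈ M.domain
    · refine hχ.contDiffAt.congr_of_eventuallyEq ?_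
      filter_upwards [M.domain.isOpen.mem_nhds hx] with y hy using fD y hy
    · obtain ⟨c, hc⟩ := flat x hx
      exact contDiffAt_const.congr_of_eventuallyEq hc
  have compact : HasCompactSupport f :=
    HasCompactSupport.intro M.outer_smooth.isBounded.isCompact_closure fun x hx =>
      fO x fun h => hx (subset_closure h)
  refine ⟨.mk' f smooth compact, fun x hx => ?_, fD, fun j x hx => fK j x (subset_closure hx)⟩
  obtain ⟨c, hc⟩ := flat x hx
  exact hc.fderiv_eq.trans (fderiv_const_apply c)

/-! ### The harmonic potentials and the space `𝒳` -/

/-- A decomposition `u = v + Ψ` with `v ∈ H¹₀` and `Ψ` smooth, locally constant off the domain and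
equal to `θ j` on the `j`-th hole; `g` is the weak gradient of `u`. -/
def IsDecomposed (θ : Fin N → ℝ) (u : L2 M.domain) (g : L2Vec M.domain) : Prop :=
  ∃ Ψ ∈ flatOff M.domain, ∃ z ∈ sobolevZero M.domain, (∀ j, ∀ x ∈ M.hole j, Ψ x = θ j) ∧
    u = z.fst + toL2 M.domain Ψ ∧ g = z.snd + gradL2 M.domain Ψ

variable {M}

theorem IsDecomposed.add {θ θ' : Fin N → ℝ} {u u' : L2 M.domain} {g g' : L2Vec M.domain}
    (h : M.IsDecomposed θ u g) (h' : M.IsDecomposed θ' u' g') :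
    M.IsDecomposed (θ + θ') (u + u') (g + g') := by
  obtain ⟨Ψ, hΨ, z, hz, hj, rfl, rfl⟩ := h
  obtain ⟨Ψ', hΨ', z', hz', hj', rfl, rfl⟩ := h'
  refine ⟨Ψ + Ψ', add_mem hΨ hΨ', z + z', add_mem hz hz', fun j x hx => ?_, ?_, ?_⟩
  · change Ψ x + Ψ' x = _
    rw [hj j x hx, hj' j x hx, Pi.add_apply]
  · rw [map_add, WithLp.add_fst]
    abel
  · rw [map_add, WithLp.add_snd]
    abel

theorem IsDecomposed.smul {θ : Fin N → ℝ} {u : L2 M.domain} {g : L2Vec M.domain} (c : ℝ)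
    (h : M.IsDecomposed θ u g) : M.IsDecomposed (c • θ) (c • u) (c • g) := by
  obtain ⟨Ψ, hΨ, z, hz, hj, rfl, rfl⟩ := h
  refine ⟨c • Ψ, Submodule.smul_mem _ _ hΨ, c • z, Submodule.smul_mem _ _ hz,
    fun j x hx => ?_, ?_, ?_⟩
  · change c * Ψ x = _
    rw [hj j x hx, Pi.smul_apply, smul_eq_mul]
  · rw [map_smul, WithLp.smul_fst, smul_add]
  · rw [map_smul, WithLp.smul_snd, smul_add]

theorem isDecomposed_of_mem {z : WithLp 2 (L2 M.domain × L2Vec M.domain)}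
    (hz : z ∈ sobolevZero M.domain) : M.IsDecomposed 0 z.fst z.snd :=
  ⟨0, zero_mem _, z, hz, fun _ _ _ => rfl, by simp, by simp⟩

theorem IsDecomposed.sum {ι : Type*} (s : Finset ι) {θ : ι → Fin N → ℝ} {u : ι → L2 M.domain}
    {g : ι → L2Vec M.domain} (h : ∀ i ∈ s, M.IsDecomposed (θ i) (u i) (g i)) :
    M.IsDecomposed (∑ i ∈ s, θ i) (∑ i ∈ s, u i) (∑ i ∈ s, g i) := by
  classical
  induction s using Finset.induction_on with
  | empty => exact isDecomposed_of_mem (zero_mem _)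
  | insert a s ha ih =>
    rw [Finset.sum_insert ha, Finset.sum_insert ha, Finset.sum_insert ha]
    exact (h a (by simp)).add (ih fun i hi => h i (by simp [hi]))

theorem IsDecomposed.hasWeakGradient {θ : Fin N → ℝ} {u : L2 M.domain} {g : L2Vec M.domain}
    (h : M.IsDecomposed θ u g) : HasWeakGradient M.domain u g := by
  obtain ⟨Ψ, hΨ, z, hz, hj, rfl, rfl⟩ := h
  exact HasWeakGradient.add (sobolevZero_le hz) (hasWeakGradient_toL2 Ψ)

variable (M)

theorem exists_poincare_of_isDecomposed : ∃ C : ℝ, ∀ θ u g, M.IsDecomposed θ u g → ‖u‖ ≤ C * ‖g‖ ∧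
    ∀ j, |θ j| * (volume (M.hole j) ^ (1 / 2 : ℝ)).toReal ≤ C * ‖g‖ := by
  obtain ⟨C, -, hC⟩ := exists_poincare M.volume_domain_ne_top
  refine ⟨C, fun θ u g h => ?_⟩
  obtain ⟨Ψ, hΨ, z, hz, hj, rfl, rfl⟩ := h
  refine ⟨(hC Ψ hΨ z hz).1, fun j => (hC Ψ hΨ z hz).2 _ (M.hole_smooth j).isOpen.measurableSet ?_
    _ (hj j)⟩
  rw [Set.disjoint_left]
  intro x hx hxD
  exact (M.mem_domain.1 hxD).2 j (subset_closure hx)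

/-- A hole is open and nonempty, so it has positive measure, and the Poincaré bound on it forces its
constant to vanish. This replaces a trace argument. -/
theorem eq_zero_of_isDecomposed_zero {θ : Fin N → ℝ} {u : L2 M.domain}
    (h : M.IsDecomposed θ u 0) : θ = 0 := by
  obtain ⟨C, hC⟩ := M.exists_poincare_of_isDecomposed
  funext j
  have h1 := (hC _ _ _ h).2 j
  rw [norm_zero, mul_zero] at h1
  have hpos : 0 < (volume (M.hole j) ^ (1 / 2 : ℝ)).toReal := by
    refine ENNReal.toReal_pos ?_ (ENNReal.rpow_ne_top_of_nonneg (by norm_num)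
      (M.hole_smooth j).isBounded.measure_lt_top.ne)
    rw [Ne, ENNReal.rpow_eq_zero_iff_of_pos (by norm_num)]
    exact ((M.hole_smooth j).isOpen.measure_pos _ (M.hole_smooth j).simplyConnected.nonempty).ne'
  have h2 : |θ j| ≤ 0 := by
    by_contra! hlt
    nlinarith
  exact abs_nonpos_iff.1 h2

theorem isHarmonicPotential_zeta (i : Fin N) : M.IsHarmonicPotential i (M.zeta i) := by
  refine Classical.epsilon_spec (p := M.IsHarmonicPotential i) ?_
  obtain ⟨χ, hχ, h0, h1⟩ := M.exists_cutoff i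
  obtain ⟨Ψ, -, hΨχ, -⟩ := M.exists_extension hχ h0 h1
  -- Lifting the boundary data: `z + Ψ` is harmonic exactly when `-Δz = ΔΨ`, which is the weak
  -- problem with field `-∇Ψ`.
  obtain ⟨z, hz, h⟩ := exists_weak_solution M.volume_domain_ne_top 0 (- gradL2 M.domain Ψ)
  have hg : HasWeakGradient M.domain (z.fst + toL2 M.domain Ψ) (z.snd + gradL2 M.domain Ψ) :=
    HasWeakGradient.add (sobolevZero_le hz) (hasWeakGradient_toL2 Ψ)
  refine ⟨z.fst + toL2 M.domain Ψ, ⟨_, hg⟩, (hg.hasWeakLaplacian_iff 0).2 fun ψ hψ => ?_,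
    χ, hχ, h0, h1, z.fst, (mem_H10_iff _).2 ⟨z.snd, hz⟩, ?_⟩
  · have h2 : inner ℝ z.snd (gradL2 M.domain ψ) = _ := h _ (jet_mem_sobolevZero hψ)
    rw [inner_add_left, h2, inner_zero_left, inner_zero_left, inner_neg_left]
    change 0 + - inner ℝ (gradL2 M.domain Ψ) (gradL2 M.domain ψ) + _ = _
    ring
  · filter_upwards [Lp.coeFn_add z.fst (toL2 M.domain Ψ), coeFn_toL2 M.domain Ψ,
      ae_restrict_mem M.domain.isOpen.measurableSet] with x hx1 hx2 hx3
    rw [hx1, Pi.add_apply, hx2, hΨχ x hx3]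

theorem isDecomposed_zeta (i : Fin N) : M.IsDecomposed (fun j => if j = i then 1 else 0)
    (M.zeta i) (weakGradient M.domain (M.zeta i)) := by
  obtain ⟨-, -, χ, hχ, h0, h1, v, hv, hζ⟩ := M.isHarmonicPotential_zeta i
  obtain ⟨Ψ, hΨ, hΨχ, hΨj⟩ := M.exists_extension hχ h0 h1
  obtain ⟨g, hg⟩ := (mem_H10_iff v).1 hv
  have hdec : M.zeta i = v + toL2 M.domain Ψ := by
    apply Lp.ext
    filter_upwards [hζ, Lp.coeFn_add v (toL2 M.domain Ψ), coeFn_toL2 M.domain Ψ,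
      ae_restrict_mem M.domain.isOpen.measurableSet] with x hx hx1 hx2 hx3
    rw [hx, hx1, Pi.add_apply, hx2, hΨχ x hx3]
  have h : M.IsDecomposed (fun j => if j = i then 1 else 0) (M.zeta i)
      (g + gradL2 M.domain Ψ) := ⟨Ψ, hΨ, _, hg, hΨj, hdec, rfl⟩
  rwa [weakGradient_eq h.hasWeakGradient]

theorem isDecomposed_sum_zeta (θ : Fin N → ℝ) : M.IsDecomposed θ (∑ i, θ i • M.zeta i)
    (∑ i, θ i • weakGradient M.domain (M.zeta i)) := by
  have h := IsDecomposed.sum Finset.univ fun i _ => (M.isDecomposed_zeta i).smul (θ i)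
  convert h
  ext j
  simp [Finset.sum_apply]

theorem p_apply (i j : Fin N) : M.p i j =
    inner ℝ (weakGradient M.domain (M.zeta i)) (weakGradient M.domain (M.zeta j)) := by
  rw [L2.inner_def]
  rfl

/-- `p` is a Gram matrix. A null vector `θ` makes the gradient of `∑ θᵢ ζᵢ` vanish, and then `θ =
0`. -/
theorem isUnit_det_p : IsUnit M.p.det := by
  rw [isUnit_iff_ne_zero]
  intro h0
  obtain ⟨θ, hθ, hp⟩ := Matrix.exists_mulVec_eq_zero_iff.2 h0
  refine hθ (M.eq_zero_of_isDecomposed_zero (u := ∑ i, θ i • M.zeta i) ?_)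
  have hz : ∑ i, θ i • weakGradient M.domain (M.zeta i) = 0 := by
    rw [← inner_self_eq_zero (𝕜 := ℝ), sum_inner]
    refine Finset.sum_eq_zero fun i _ => ?_
    have h1 : ∑ j, M.p i j * θ j = 0 := congrFun hp i
    rw [inner_smul_left, inner_sum]
    simp only [inner_smul_right, ← p_apply]
    rw [Finset.sum_congr rfl fun j _ => mul_comm (θ j) (M.p i j), h1, mul_zero]
  exact hz ▸ M.isDecomposed_sum_zeta θ

theorem exists_isDecomposed_of_mem_spaceX {u : L2 M.domain} (hu : u ∈ M.spaceX) :
    ∃ θ, M.IsDecomposed θ u (weakGradient M.domain u) := by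
  obtain ⟨-, v, hv, θ, rfl⟩ := hu
  obtain ⟨g, hg⟩ := (mem_H10_iff v).1 hv
  have h := (isDecomposed_of_mem hg).add (M.isDecomposed_sum_zeta θ)
  have hg' := weakGradient_eq h.hasWeakGradient
  exact ⟨_, hg'.symm ▸ h⟩

theorem mem_spaceX_of_H10 {v : L2 M.domain} (hv : v ∈ H10 M.domain) (θ : Fin N → ℝ) :
    v + ∑ i, θ i • M.zeta i ∈ M.spaceX := by
  obtain ⟨g, hg⟩ := (mem_H10_iff v).1 hv
  have h := (isDecomposed_of_mem hg).add (M.isDecomposed_sum_zeta θ)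
  exact ⟨⟨_, h.hasWeakGradient⟩, v, hv, θ, rfl⟩

theorem toL2_mem_spaceX {ψ : SmoothCompact} (hψ : ψ ∈ supportedIn M.domain) :
    toL2 M.domain ψ ∈ M.spaceX := by
  simpa using M.mem_spaceX_of_H10 ((mem_H10_iff _).2 ⟨_, jet_mem_sobolevZero hψ⟩) 0

theorem smul_mem_spaceX (c : ℝ) {u : L2 M.domain} (hu : u ∈ M.spaceX) : c • u ∈ M.spaceX := by
  obtain ⟨-, v, hv, θ, rfl⟩ := hu
  obtain ⟨g, hg⟩ := (mem_H10_iff v).1 hv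
  have := M.mem_spaceX_of_H10 ((mem_H10_iff (c • v)).2
    ⟨c • g, (sobolevZero M.domain).smul_mem c hg⟩) (c • θ)
  simpa only [smul_add, Finset.smul_sum, smul_smul, Pi.smul_apply, smul_eq_mul] using this

/-- A normalized bump function in `D`. It keeps the real infimum and supremum away from their
default value `0` on the empty set. -/
theorem exists_unit_mem_spaceX : ∃ u ∈ M.spaceX, ‖u‖ = 1 := by
  obtain ⟨x, hx⟩ := M.domain_nonempty
  obtain ⟨f, hsupp, hc, hf, -, hfx⟩ :=
    exists_contDiff_tsupport_subset (n := ⊤) (M.domain.isOpen.mem_nhds hx)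
  let ψ : SmoothCompact := .mk' f hf hc
  have h0 : toL2 M.domain ψ ≠ 0 := by
    intro h
    have hae : ∀ᵐ y ∂(vol M.domain), f y = 0 := by
      filter_upwards [coeFn_toL2 M.domain ψ, Lp.coeFn_zero ℝ 2 (vol M.domain)] with y h1 h2
      have h3 : f y = toL2 M.domain ψ y := h1.symm
      rw [h3, h, h2]
      rfl
    have hpos : 0 < volume {y | f y ≠ 0} :=
      (hf.continuous.isOpen_support).measure_pos _ ⟨x, by simp [hfx]⟩
    rw [ae_restrict_iff' M.domain.isOpen.measurableSet] at hae
    refine hpos.ne' (ae_iff.1 ?_)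
    filter_upwards [hae] with y hy
    by_contra hy'
    exact hy' (hy (hsupp (subset_tsupport f hy')))
  refine ⟨‖toL2 M.domain ψ‖⁻¹ • toL2 M.domain ψ, M.smul_mem_spaceX _ (M.toL2_mem_spaceX hsupp), ?_⟩
  rw [norm_smul, norm_inv, norm_norm, inv_mul_cancel₀ (norm_ne_zero_iff.2 h0)]

/-! ### The variational characterization of `𝒫` -/

/-- The coefficients of `𝒫 φ - 𝒢 φ`. -/
def coeffP (φ : L2 M.domain) (j : Fin N) : ℝ := ∑ i, M.q i j * inner ℝ φ (M.zeta i)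

theorem opP_eq (φ : L2 M.domain) :
    M.opP φ = green M.domain φ + ∑ j, M.coeffP φ j • M.zeta j := by
  rw [opP, Finset.sum_comm]
  congr 1
  refine Finset.sum_congr rfl fun j _ => ?_
  rw [coeffP, Finset.sum_smul]
  refine Finset.sum_congr rfl fun i _ => ?_
  rw [L2.inner_def]
  rfl

/-- From `q p = 1`: the coefficients are exactly those for which the harmonic part of `𝒫φ` solves
the variational problem against each `ζₖ`. -/
theorem sum_coeffP_mul_p (φ : L2 M.domain) (k : Fin N) :
    ∑ j, M.coeffP φ j * M.p j k = inner ℝ φ (M.zeta k) := by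
  have h : ∀ i, ∑ j, M.q i j * M.p j k = if i = k then 1 else 0 := fun i => by
    rw [← Matrix.mul_apply, q, Matrix.nonsing_inv_mul _ M.isUnit_det_p, Matrix.one_apply]
  simp only [coeffP, Finset.sum_mul]
  rw [Finset.sum_comm]
  calc ∑ i, ∑ j, M.q i j * inner ℝ φ (M.zeta i) * M.p j k
      = ∑ i, inner ℝ φ (M.zeta i) * ∑ j, M.q i j * M.p j k := by
        refine Finset.sum_congr rfl fun i _ => ?_
        rw [Finset.mul_sum]
        exact Finset.sum_congr rfl fun j _ => by ring
    _ = inner ℝ φ (M.zeta k) := by simp [h]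

theorem solutionOperator :
    SolutionOperator M.spaceX (weakGradient M.domain) M.opP where
  smul_mem c u hu := M.smul_mem_spaceX c hu
  map_smul c u hu := by
    obtain ⟨θ, h⟩ := M.exists_isDecomposed_of_mem_spaceX hu
    exact weakGradient_eq (h.hasWeakGradient.smul c)
  mem φ := by
    rw [opP_eq]
    exact M.mem_spaceX_of_H10 (green_spec M.volume_domain_ne_top φ).1 _
  inner_map φ w hw := by
    obtain ⟨-, v, hv, θ, rfl⟩ := hw
    obtain ⟨hG, hGL⟩ := green_spec M.volume_domain_ne_top φ
    obtain ⟨g, hg⟩ := (mem_H10_iff v).1 hv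
    obtain ⟨k, hk⟩ := (mem_H10_iff _).1 hG
    have e1 := weakGradient_eq ((isDecomposed_of_mem hg).add
      (M.isDecomposed_sum_zeta θ)).hasWeakGradient
    have e2 := weakGradient_eq ((isDecomposed_of_mem hk).add
      (M.isDecomposed_sum_zeta (M.coeffP φ))).hasWeakGradient
    -- Harmonicity of `ζⱼ` kills both mixed terms `a2` and `a3`. The remaining blocks are the Green
    -- identity `a1` and the finite-dimensional identity `a4`.
    have hζ : ∀ j, ∀ z ∈ sobolevZero M.domain,
        inner ℝ (weakGradient M.domain (M.zeta j)) z.snd = 0 := fun j z hz => by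
      have := (M.isHarmonicPotential_zeta j).2.1.inner_eq
        (M.isDecomposed_zeta j).hasWeakGradient hz
      rwa [inner_zero_left, neg_zero] at this
    have a1 : inner ℝ k g = inner ℝ φ v := by
      have := hGL.inner_eq (sobolevZero_le hk) hg
      rwa [inner_neg_left, neg_neg] at this
    have a2 : inner ℝ k (∑ i, θ i • weakGradient M.domain (M.zeta i)) = 0 := by
      rw [inner_sum]
      refine Finset.sum_eq_zero fun i _ => ?_
      rw [inner_smul_right, real_inner_comm]
      exact mul_eq_zero_of_right _ (hζ i _ hk)
    have a3 : inner ℝ (∑ i, M.coeffP φ i • weakGradient M.domain (M.zeta i)) g = 0 := by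
      rw [sum_inner]
      refine Finset.sum_eq_zero fun i _ => ?_
      rw [inner_smul_left]
      exact mul_eq_zero_of_right _ (hζ i _ hg)
    have a4 : inner ℝ (∑ i, M.coeffP φ i • weakGradient M.domain (M.zeta i))
        (∑ i, θ i • weakGradient M.domain (M.zeta i)) = ∑ i, θ i * inner ℝ φ (M.zeta i) := by
      rw [inner_sum]
      refine Finset.sum_congr rfl fun i _ => ?_
      rw [inner_smul_right, sum_inner, ← M.sum_coeffP_mul_p]
      simp only [inner_smul_left, p_apply, conj_trivial]
    rw [opP_eq]
    refine (congrArg₂ (inner ℝ) e2 e1).trans ?_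
    change inner ℝ (k + _) (g + _) = _
    rw [inner_add_left, inner_add_right, inner_add_right, a1, a2, a3, a4, inner_add_right,
      inner_sum]
    simp only [inner_smul_right]
    ring
  poincare := by
    obtain ⟨C, hC⟩ := M.exists_poincare_of_isDecomposed
    refine ⟨C, fun u hu => ?_⟩
    obtain ⟨θ, h⟩ := M.exists_isDecomposed_of_mem_spaceX hu
    exact (hC _ _ _ h).1
  exists_unit := M.exists_unit_mem_spaceX

/-! ### Transfer of the abstract duality to `λ`, `Λ` and their optimizers -/

theorem formP_eq (φ : L2 M.domain) : M.formP φ = inner ℝ φ (M.opP φ) := by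
  rw [real_inner_comm, L2.inner_def]
  rfl

theorem Lam_eq : M.Lam = formSup M.opP := by
  simp only [Lam, formSup, formP_eq]

theorem lam_eq : M.lam = quotientInf M.spaceX (weakGradient M.domain) := by
  simp only [lam, quotientInf, dirichletEnergy_eq]

theorem isMinimizer_of_isMaximizer {φ : L2 M.domain} (hφ : M.IsMaximizer φ) :
    M.IsMinimizer (M.Lam⁻¹ • M.opP φ) := by
  have h := M.solutionOperator
  have hn := hφ.1
  have hmax : inner ℝ φ (M.opP φ) = M.Lam := by rw [← formP_eq, hφ.2]
  have hpos : 0 < M.Lam := by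
    rw [Lam_eq, h.formSup_eq]
    exact inv_pos.2 h.quotientInf_pos
  -- The proposed minimizer is the maximizer itself, which settles the normalization; its energy is
  -- `Λ⁻² · Λ = Λ⁻¹ = λ`.
  have heq : M.Lam⁻¹ • M.opP φ = φ := by
    rw [h.eq_smul_of_maximizer hn (by rw [hmax, Lam_eq]), ← Lam_eq, smul_smul,
      inv_mul_cancel₀ hpos.ne', one_smul]
  refine ⟨h.smul_mem _ _ (h.mem φ), by rw [heq, hn], ?_⟩
  rw [dirichletEnergy_eq, h.map_smul _ _ (h.mem φ), norm_smul, mul_pow, ← h.inner_self, hmax,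
    lam_eq, ← inv_inv (quotientInf _ _), ← h.formSup_eq, ← Lam_eq, Real.norm_eq_abs, sq_abs]
  field_simp

theorem exists_isMaximizer_of_isMinimizer {u : L2 M.domain} (hu : M.IsMinimizer u) :
    ∃ f : L2 M.domain, HasWeakLaplacian M.domain u f ∧ M.IsMaximizer (M.lam⁻¹ • (-f)) := by
  have h := M.solutionOperator
  obtain ⟨hX, hn, hE⟩ := hu
  rw [dirichletEnergy_eq] at hE
  have hpos : 0 < M.lam := lam_eq M ▸ h.quotientInf_pos
  have hG := h.map_eq_smul_of_minimizer hX hn (by rw [hE, lam_eq])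
  rw [← lam_eq] at hG
  obtain ⟨θ, hdec⟩ := M.exists_isDecomposed_of_mem_spaceX hX
  -- The gradient identity `∇𝒫u = λ⁻¹ ∇u`, tested against `C_c^∞(D)`, says `-Δu = λu`. So `λ⁻¹(-Δu)`
  -- is `u` itself, with form value `‖∇𝒫u‖² = λ⁻² · λ = Λ`.
  refine ⟨-(M.lam • u), (hdec.hasWeakGradient.hasWeakLaplacian_iff _).2 fun ψ hψ => ?_, ?_⟩
  · have h1 := h.inner_map u _ (M.toL2_mem_spaceX hψ)
    rw [hG, inner_smul_left, weakGradient_eq (hasWeakGradient_toL2 ψ), conj_trivial,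
      inv_mul_eq_iff_eq_mul₀ hpos.ne'] at h1
    rw [h1, inner_neg_left, neg_neg, inner_smul_left, conj_trivial]
  · rw [neg_neg, smul_smul, inv_mul_cancel₀ hpos.ne', one_smul]
    refine ⟨hn, ?_⟩
    rw [formP_eq, h.inner_self, hG, norm_smul, mul_pow, hE, Lam_eq, h.formSup_eq, ← lam_eq,
      Real.norm_eq_abs, sq_abs]
    field_simp

end MultiplyConnected

end HoledDomain

end

theorem proposition3p4 {N : ℕ} (M : HoledDomain.MultiplyConnected N) :
    M.lam * M.Lam = 1 ∧
    (∀ φ : HoledDomain.L2 M.domain, M.IsMaximizer φ → M.IsMinimizer (M.Lam⁻¹ • M.opP φ)) ∧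
    (∀ u : HoledDomain.L2 M.domain, M.IsMinimizer u →
      ∃ f : HoledDomain.L2 M.domain, HoledDomain.HasWeakLaplacian M.domain u f ∧
        M.IsMaximizer (M.lam⁻¹ • (-f))) := by
  refine ⟨?_, fun φ hφ => M.isMinimizer_of_isMaximizer hφ,
    fun u hu => M.exists_isMaximizer_of_isMinimizer hu⟩
  rw [M.lam_eq, M.Lam_eq, M.solutionOperator.quotientInf_mul_formSup]
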